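/- **Proposition 3.5.** Let $M$ be a smooth (Hausdorff) manifold of dimension $2n+1$, and let $(\eta,g)$ be a contact metric structure on $M$ with Reeb vector field $\xi$ and associated $(1,1)$-tensor field $\Phi$. That is: $\eta$ is a smooth contact form (it vanishes nowhere and $d\eta$ is nondegenerate on $\mathcal D=\ker\eta$); $\xi$ is a smooth vector field with $\eta(\xi)=1$ and $d\eta(\xi,\cdot)=0$; $\Phi$ is a smooth section of $\operatorname{End}TM$ and $g$ is a smooth Riemannian metric such that $$\Phi\xi=0,\qquad \Phi^2=-\mathbb I+\xi\otimes\eta,\qquad g(\Phi X,\Phi Y)=g(X,Y)-\eta(X)\eta(Y),\qquad g(X,Y)=d\eta(X,\Phi Y)+\eta(X)\eta(Y)$$ for all tangent vectors $X,Y$ at a common point. Here $d\eta(X,Y)=X(\eta(Y))-Y(\eta(X))-\eta([X,Y])$, without a factor $\tfrac12$. Let $J=\Phi|_{\mathcal D}$ be the corresponding almost CR structure on $\mathcal D$. Then the following are equivalent. 1. The structure is normal (Sasakian): $N_\Phi=-d\eta\otimes\xi$, where for all smooth vector fields $X,Y$ on $M$ $$N_\Phi(X,Y)=[\Phi X,\Phi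 Y]+\Phi^2[X,Y]-\Phi[X,\Phi Y]-\Phi[\Phi X,Y].$$ 2. The almost CR structure $J$ is integrable, i.e. for all smooth sections $X,Y$ of $\mathcal D$ the vector field $[X,JY]+[JX,Y]$ is a section of $\mathcal D$ and $$J\bigl([X,JY]+[JX,Y]\bigr)=[JX,JY]-[X,Y];$$ and moreover $\mathcal L_\xi\Phi=0$, i.e. $[\xi,\Phi Y]=\Phi[\xi,Y]$ for every smooth vector field $Y$ on $M$. -/

import Mathlib

open scoped Manifold ContDiff Bundle

noncomputable section

namespace ContactGeometry

variable {d : ℕ} {M : Type*} [TopologicalSpace M] [ChartedSpace (EuclideanSpace ℝ (Fin d)) M]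

/-! ### Smooth vector fields, one-forms, endomorphism fields, and the exterior derivative -/

/-- The vector field `X` on `M` is smooth. -/
def IsSmoothVectorField [IsManifold (𝓡 d) ∞ M] (X : ∀ x : M, TangentSpace (𝓡 d) x) : Prop :=
  ContMDiff (𝓡 d) ((𝓡 d).prod 𝓘(ℝ, EuclideanSpace ℝ (Fin d))) ∞
    (fun x => Bundle.TotalSpace.mk' (EuclideanSpace ℝ (Fin d))
      (E := fun y : M => TangentSpace (𝓡 d) y) x (X x))

/-- The one-form `η` on `M` is smooth, as a section of the cotangent bundle. -/
def IsSmoothOneForm [IsManifold (𝓡 d) ∞ M] (η : ∀ x : M, TangentSpace (𝓡 d) x →L[ℝ] ℝ) : Prop :=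
  ContMDiff (𝓡 d) ((𝓡 d).prod 𝓘(ℝ, EuclideanSpace ℝ (Fin d) →L[ℝ] ℝ)) ∞
    (fun x => Bundle.TotalSpace.mk' (EuclideanSpace ℝ (Fin d) →L[ℝ] ℝ)
      (E := fun y : M => TangentSpace (𝓡 d) y →L[ℝ] ℝ) x (η x))

/-- The field of endomorphisms `Φ` is smooth, as a section of the bundle `End TM`. -/
def IsSmoothEndo [IsManifold (𝓡 d) ∞ M]
    (Φ : ∀ x : M, TangentSpace (𝓡 d) x →L[ℝ] TangentSpace (𝓡 d) x) : Prop :=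
  ContMDiff (𝓡 d)
    ((𝓡 d).prod 𝓘(ℝ, EuclideanSpace ℝ (Fin d) →L[ℝ] EuclideanSpace ℝ (Fin d))) ∞
    (fun x => Bundle.TotalSpace.mk' (EuclideanSpace ℝ (Fin d) →L[ℝ] EuclideanSpace ℝ (Fin d))
      (E := fun y : M => TangentSpace (𝓡 d) y →L[ℝ] TangentSpace (𝓡 d) y) x (Φ x))

/-- The pullback of the one-form `η` by the inverse of the preferred chart at `x₀`: a one-form on
the model space (meaningful on the target of the chart, which is open). -/
def oneFormInChart (η : ∀ x : M, TangentSpace (𝓡 d) x →L[ℝ] ℝ) (x₀ : M) :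
    EuclideanSpace ℝ (Fin d) → (EuclideanSpace ℝ (Fin d)) [⋀^Fin 1]→L[ℝ] ℝ := fun y =>
  ContinuousAlternatingMap.ofSubsingleton ℝ (EuclideanSpace ℝ (Fin d)) ℝ (0 : Fin 1)
    ((η ((extChartAt (𝓡 d) x₀).symm y)).comp
      (mfderiv 𝓘(ℝ, EuclideanSpace ℝ (Fin d)) (𝓡 d) (extChartAt (𝓡 d) x₀).symm y))

/-- The exterior derivative `dη` of a one-form, computed at `x` in the preferred chart at `x`.
The normalization is `dη(X, Y) = X(η(Y)) - Y(η(X)) - η([X, Y])`, without a factor `1/2`. -/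
def dOneForm (η : ∀ x : M, TangentSpace (𝓡 d) x →L[ℝ] ℝ) (x : M)
    (v w : TangentSpace (𝓡 d) x) : ℝ :=
  extDeriv (oneFormInChart η x) (extChartAt (𝓡 d) x x)
    ![mfderiv (𝓡 d) 𝓘(ℝ, EuclideanSpace ℝ (Fin d)) (extChartAt (𝓡 d) x) x v,
      mfderiv (𝓡 d) 𝓘(ℝ, EuclideanSpace ℝ (Fin d)) (extChartAt (𝓡 d) x) x w]

/-! ### Almost CR structures and their integrability -/

/-- For a distribution `D` and a field `J` of endomorphisms of `D`, the almost CR structure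
`(D, J)` is integrable: for all smooth sections `X`, `Y` of `D`, the vector field
`[X, JY] + [JX, Y]` is a section of `D`, and `J([X, JY] + [JX, Y]) = [JX, JY] - [X, Y]`. -/
def IsIntegrableCR [IsManifold (𝓡 d) ∞ M] (D : ∀ x : M, Submodule ℝ (TangentSpace (𝓡 d) x))
    (J : ∀ x : M, D x →ₗ[ℝ] D x) : Prop :=
  ∀ X Y : ∀ x : M, D x,
    IsSmoothVectorField (fun x => (X x : TangentSpace (𝓡 d) x)) →
    IsSmoothVectorField (fun x => (Y x : TangentSpace (𝓡 d) x)) →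
    ∀ x : M, ∃ h :
      VectorField.mlieBracket (𝓡 d) (fun y => (X y : TangentSpace (𝓡 d) y))
          (fun y => (J y (Y y) : TangentSpace (𝓡 d) y)) x
        + VectorField.mlieBracket (𝓡 d) (fun y => (J y (X y) : TangentSpace (𝓡 d) y))
          (fun y => (Y y : TangentSpace (𝓡 d) y)) x ∈ D x,
      (J x ⟨_, h⟩ : TangentSpace (𝓡 d) x) =
        VectorField.mlieBracket (𝓡 d) (fun y => (J y (X y) : TangentSpace (𝓡 d) y))
          (fun y => (J y (Y y) : TangentSpace (𝓡 d) y)) x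
        - VectorField.mlieBracket (𝓡 d) (fun y => (X y : TangentSpace (𝓡 d) y))
          (fun y => (Y y : TangentSpace (𝓡 d) y)) x

/-! ### Tensors attached to a field of endomorphisms -/

/-- The Nijenhuis tensor
`N_Φ(X, Y) = [ΦX, ΦY] + Φ²[X, Y] - Φ[X, ΦY] - Φ[ΦX, Y]`. -/
def nijenhuis (Φ : ∀ x : M, TangentSpace (𝓡 d) x →L[ℝ] TangentSpace (𝓡 d) x)
    (X Y : ∀ x : M, TangentSpace (𝓡 d) x) (x : M) : TangentSpace (𝓡 d) x :=
  VectorField.mlieBracket (𝓡 d) (fun y => Φ y (X y)) (fun y => Φ y (Y y)) x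
    + Φ x (Φ x (VectorField.mlieBracket (𝓡 d) X Y x))
    - Φ x (VectorField.mlieBracket (𝓡 d) X (fun y => Φ y (Y y)) x)
    - Φ x (VectorField.mlieBracket (𝓡 d) (fun y => Φ y (X y)) Y x)

/-- The Lie derivative of a `(1,1)`-tensor field:
`(L_ξ Φ)(Y) = [ξ, ΦY] - Φ[ξ, Y]`. -/
def lieDerivEndo (ξ : ∀ x : M, TangentSpace (𝓡 d) x)
    (Φ : ∀ x : M, TangentSpace (𝓡 d) x →L[ℝ] TangentSpace (𝓡 d) x)
    (Y : ∀ x : M, TangentSpace (𝓡 d) x) (x : M) : TangentSpace (𝓡 d) x :=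
  VectorField.mlieBracket (𝓡 d) ξ (fun y => Φ y (Y y)) x
    - Φ x (VectorField.mlieBracket (𝓡 d) ξ Y x)

/-! ### Contact metric structures -/

/-- A smooth one-form `η` is a contact form: it vanishes nowhere and `dη` is nondegenerate on
`ker η`. On a manifold of dimension `2n+1` this says that `η ∧ (dη)ⁿ` vanishes nowhere. -/
structure IsContactForm [IsManifold (𝓡 d) ∞ M]
    (η : ∀ x : M, TangentSpace (𝓡 d) x →L[ℝ] ℝ) : Prop where
  smooth : IsSmoothOneForm η
  ne_zero : ∀ x, η x ≠ 0
  nondegenerate : ∀ (x : M) (v : TangentSpace (𝓡 d) x), η x v = 0 →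
    (∀ w : TangentSpace (𝓡 d) x, η x w = 0 → dOneForm η x v w = 0) → v = 0

variable (d M) in
/-- A contact metric structure `(η, g)` on `M`, together with its Reeb vector field `ξ` and its
endomorphism field `Φ` (both of which are determined by `η` and `g`). -/
structure ContactMetricStructure [IsManifold (𝓡 d) ∞ M] where
  /-- the contact form -/
  η : ∀ x : M, TangentSpace (𝓡 d) x →L[ℝ] ℝ
  /-- the Reeb vector field -/
  ξ : ∀ x : M, TangentSpace (𝓡 d) x
  /-- the `(1,1)`-tensor field extending the almost complex structure on `ker η` -/
  Φ : ∀ x : M, TangentSpace (𝓡 d) x →L[ℝ] TangentSpace (𝓡 d) x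
  /-- the Riemannian metric -/
  g : Bundle.ContMDiffRiemannianMetric (𝓡 d) ∞ (EuclideanSpace ℝ (Fin d))
    (fun x : M => TangentSpace (𝓡 d) x)
  contact : IsContactForm η
  smooth_ξ : IsSmoothVectorField ξ
  smooth_Φ : IsSmoothEndo Φ
  η_ξ : ∀ x, η x (ξ x) = 1
  dη_ξ : ∀ (x : M) (v : TangentSpace (𝓡 d) x), dOneForm η x (ξ x) v = 0
  Φ_ξ : ∀ x, Φ x (ξ x) = 0
  Φ_sq : ∀ (x : M) (v : TangentSpace (𝓡 d) x), Φ x (Φ x v) = -v + η x v • ξ x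
  g_Φ : ∀ (x : M) (v w : TangentSpace (𝓡 d) x),
    g.inner x (Φ x v) (Φ x w) = g.inner x v w - η x v * η x w
  g_eq : ∀ (x : M) (v w : TangentSpace (𝓡 d) x),
    g.inner x v w = dOneForm η x v (Φ x w) + η x v * η x w

namespace ContactMetricStructure

variable [IsManifold (𝓡 d) ∞ M] (S : ContactMetricStructure d M)

/-- The contact distribution `D = ker η`. -/
def D (x : M) : Submodule ℝ (TangentSpace (𝓡 d) x) := LinearMap.ker (S.η x).toLinearMap

theorem Φ_mem_D (x : M) (v : TangentSpace (𝓡 d) x) : S.Φ x v ∈ S.D x := by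
  have h1 : S.Φ x (S.Φ x (S.Φ x v)) = -S.Φ x v := by
    rw [S.Φ_sq x v, map_add, map_neg, map_smul, S.Φ_ξ, smul_zero, add_zero]
  rw [S.Φ_sq x (S.Φ x v)] at h1
  have h2 : S.η x (S.Φ x v) • S.ξ x = 0 := by simpa using h1
  have h3 := congrArg (S.η x) h2
  rw [map_smul, S.η_ξ, map_zero, smul_eq_mul, mul_one] at h3
  exact h3

/-- The almost complex structure `J` on `D`, the restriction of `Φ`. -/
def J (x : M) : S.D x →ₗ[ℝ] S.D x :=
  (S.Φ x).toLinearMap.restrict (fun v _ => S.Φ_mem_D x v)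

/-- The structure is normal (Sasakian): `N_Φ = -dη ⊗ ξ`. -/
def IsNormal : Prop :=
  ∀ X Y : ∀ x : M, TangentSpace (𝓡 d) x, IsSmoothVectorField X → IsSmoothVectorField Y →
    ∀ x : M, nijenhuis S.Φ X Y x = -(dOneForm S.η x (X x) (Y x) • S.ξ x)

/-- The Lie derivative `L_ξ Φ` vanishes. -/
def LieDerivVanishes : Prop :=
  ∀ Y : ∀ x : M, TangentSpace (𝓡 d) x, IsSmoothVectorField Y →
    ∀ x : M, lieDerivEndo S.ξ S.Φ Y x = 0

end ContactMetricStructure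

end ContactGeometry

end

open scoped Topology
open VectorField Set

namespace ContactGeometry

/-! If `η(X)` and `η(Y)` are constant, then `dη(X, Y) = -η([X, Y])`; this is the only form of
Cartan's formula needed. For sections of `D`, expanding `Φ²[X, Y] = -[X, Y] + η([X, Y])ξ` in `N_Φ(X,
Y) = -dη(X, Y)ξ` makes the `ξ` terms cancel and leaves exactly the CR identity. That `[X, JY] + [JX,
Y]` lies in `D` is automatic, by symmetry of `g`.

In the Reeb direction, `N_Φ(ξ, Y) = -Φ((L_ξ Φ)Y)`. Since `η((L_ξ Φ)Y) = 0` always and `ker Φ` is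
spanned by `ξ`, normality forces `L_ξ Φ = 0`. Conversely, splitting `X = -Φ²X + η(X)ξ` reduces
normality to sections of `D`: the `ξ` part contributes nothing to `N_Φ` when `L_ξ Φ = 0`, and
nothing to `dη`. -/

/-- The formula `dθ(X, Y) = X(θ(Y)) - Y(θ(X)) - θ([X, Y])` for vector fields on which `θ` is locally
constant. -/
theorem extDeriv_apply_of_eventually_const {E : Type*} [NormedAddCommGroup E] [NormedSpace ℝ E]
    {θ : E → E [⋀^Fin 1]→L[ℝ] ℝ} {X Y : E → E} {x : E} (hθ : DifferentiableAt ℝ θ x)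
    (hX : DifferentiableAt ℝ X x) (hY : DifferentiableAt ℝ Y x) {a b : ℝ}
    (ha : ∀ᶠ y in 𝓝 x, θ y ![X y] = a) (hb : ∀ᶠ y in 𝓝 x, θ y ![Y y] = b) :
    extDeriv θ x ![X x, Y x] = -θ x ![lieBracket ℝ X Y x] := by
  have key := extDeriv_apply_vectorField (V := ![X, Y]) hθ
    (Fin.forall_fin_two.2 ⟨hX, hY⟩)
  have e0 : (fun i => ![X, Y] i x) = ![X x, Y x] := by
    funext i; fin_cases i <;> rfl
  have r0 (y : E) : (0 : Fin 2).removeNth (fun i => ![X, Y] i y) = ![Y y] := by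
    funext i; fin_cases i; rfl
  have r1 (y : E) : (1 : Fin 2).removeNth (fun i => ![X, Y] i y) = ![X y] := by
    funext i; fin_cases i; rfl
  have d0 : fderiv ℝ (fun y => θ y ![X y]) x = 0 := by
    rw [Filter.EventuallyEq.fderiv_eq (f := fun _ => a) ha, fderiv_fun_const]; rfl
  have d1 : fderiv ℝ (fun y => θ y ![Y y]) x = 0 := by
    rw [Filter.EventuallyEq.fderiv_eq (f := fun _ => b) hb, fderiv_fun_const]; rfl
  have c (u : E) (f : Fin 0 → E) : Matrix.vecCons u f = ![u] := by
    funext i; fin_cases i; rfl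
  rw [e0] at key
  rw [key, Fin.sum_univ_two]
  simp only [r0, r1, d0, d1, c]
  simp

/-- Bridge between normality and the CR identity on `D`: take `a = [ΦX, ΦY]`, `b = [X, Y]`, `c =
η([X, Y])`, `z = ξ`. -/
theorem add_sub_sub_eq_neg_neg_smul_iff {V : Type*} [AddCommGroup V] [Module ℝ V]
    {a b p q z : V} {c : ℝ} : a + (-b + c • z) - p - q = -(-c • z) ↔ p + q = a - b := by
  constructor <;> intro h
  · rw [neg_smul, neg_neg, sub_sub, sub_eq_iff_eq_add] at h
    exact add_left_cancel (a := c • z) (h.symm.trans (by abel))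
  · rw [neg_smul, neg_neg, sub_sub, h]
    abel

/-! ### Cartan's formula on the manifold -/

section

variable {d : ℕ} {M : Type*} [TopologicalSpace M] [ChartedSpace (EuclideanSpace ℝ (Fin d)) M]
  [IsManifold (𝓡 d) ∞ M]

/-- Near the base point this is the expression of `η` in the tangent bundle trivialization, composed
with the inverse chart. -/
theorem differentiableAt_oneFormInChart {η : ∀ x : M, TangentSpace (𝓡 d) x →L[ℝ] ℝ}
    (hη : IsSmoothOneForm η) (x : M) :
    DifferentiableAt ℝ (oneFormInChart η x) (extChartAt (𝓡 d) x x) := by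
  have h1 := ((contMDiffAt_hom_bundle _).1 (hη x)).2
  have h2 : ContMDiffAt 𝓘(ℝ, EuclideanSpace ℝ (Fin d)) (𝓡 d) ∞ (extChartAt (𝓡 d) x).symm
      (extChartAt (𝓡 d) x x) :=
    (contMDiffOn_extChartAt_symm x).contMDiffAt (extChartAt_target_mem_nhds x)
  have h3 := ContMDiffAt.comp_of_eq h1 h2 (extChartAt_to_inv x)
  have h4 := h3.contDiffAt.differentiableAt (by simp)
  let L : (EuclideanSpace ℝ (Fin d) →L[ℝ] ℝ) ≃ₗᵢ[ℝ]
      (EuclideanSpace ℝ (Fin d) [⋀^Fin 1]→L[ℝ] ℝ) :=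
    ContinuousAlternatingMap.ofSubsingletonLIE (0 : Fin 1)
  have h5 := L.differentiable.differentiableAt.comp _ h4
  refine h5.congr_of_eventuallyEq ?_
  filter_upwards [extChartAt_target_mem_nhds (I := 𝓡 d) x] with y hy
  simp only [Function.comp_def, oneFormInChart]
  have hb : (extChartAt (𝓡 d) x).symm y ∈ (chartAt (EuclideanSpace ℝ (Fin d)) x).source := by
    simpa only [extChartAt_source] using (extChartAt (𝓡 d) x).map_target hy
  refine congrArg _ (ContinuousLinearMap.ext fun v => ?_)
  simp only [ContinuousLinearMap.inCoordinates]
  rw [TangentBundle.symmL_trivializationAt hb, (extChartAt (𝓡 d) x).right_inv hy]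
  have hr : range (𝓡 d) = univ := by simp
  rw [hr, mfderivWithin_univ]
  exact (DFunLike.congr_fun (Bundle.Trivial.continuousLinearMapAt_trivialization
    ℝ M ℝ ((extChartAt (𝓡 d) x).symm y)) _).symm

/-- `dη(X, Y) = -η([X, Y])` for vector fields `X`, `Y` on which `η` is constant. -/
theorem dOneForm_eq_neg_apply_mlieBracket {η : ∀ x : M, TangentSpace (𝓡 d) x →L[ℝ] ℝ}
    (hη : IsSmoothOneForm η) {X Y : ∀ x : M, TangentSpace (𝓡 d) x}
    (hX : IsSmoothVectorField X) (hY : IsSmoothVectorField Y) {a b : ℝ}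
    (hηX : ∀ x, η x (X x) = a) (hηY : ∀ x, η x (Y x) = b) (x : M) :
    dOneForm η x (X x) (Y x) = -η x (mlieBracket (𝓡 d) X Y x) := by
  have hr : range (𝓡 d) = univ := by simp
  have dV (V : ∀ x : M, TangentSpace (𝓡 d) x) (hV : IsSmoothVectorField V) :
      DifferentiableAt ℝ (mpullback 𝓘(ℝ, EuclideanSpace ℝ (Fin d)) (𝓡 d)
        (extChartAt (𝓡 d) x).symm V) (extChartAt (𝓡 d) x x) := by
    have := (((hV x).mdifferentiableAt (by simp)).mdifferentiableWithinAt
      (s := univ)).differentiableWithinAt_mpullbackWithin_vectorField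
    rw [hr, preimage_univ, univ_inter, mpullbackWithin_univ] at this
    exact differentiableWithinAt_univ.1 this
  have hinv (y) (hy : y ∈ (extChartAt (𝓡 d) x).target) :
      (mfderiv 𝓘(ℝ, EuclideanSpace ℝ (Fin d)) (𝓡 d) (extChartAt (𝓡 d) x).symm y).IsInvertible := by
    have := isInvertible_mfderivWithin_extChartAt_symm hy
    rwa [hr, mfderivWithin_univ] at this
  -- Pulling back both the form and the field preserves their pairing, so constancy carries over to
  -- the chart.
  have cV (V : ∀ x : M, TangentSpace (𝓡 d) x) (c : ℝ) (hV : ∀ x, η x (V x) = c) :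
      ∀ᶠ y in 𝓝 (extChartAt (𝓡 d) x x), oneFormInChart η x y ![mpullback
        𝓘(ℝ, EuclideanSpace ℝ (Fin d)) (𝓡 d) (extChartAt (𝓡 d) x).symm V y] = c := by
    filter_upwards [extChartAt_target_mem_nhds (I := 𝓡 d) x] with y hy
    rw [← hV ((extChartAt (𝓡 d) x).symm y)]
    exact congrArg (η ((extChartAt (𝓡 d) x).symm y)) ((hinv y hy).self_apply_inverse _)
  have key := extDeriv_apply_of_eventually_const (differentiableAt_oneFormInChart hη x)
    (dV X hX) (dV Y hY) (cV X a hηX) (cV Y b hηY)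
  have hsymm (v : TangentSpace (𝓡 d) x) :
      (mfderiv 𝓘(ℝ, EuclideanSpace ℝ (Fin d)) (𝓡 d) (extChartAt (𝓡 d) x).symm
        (extChartAt (𝓡 d) x x) (mfderiv (𝓡 d) 𝓘(ℝ, EuclideanSpace ℝ (Fin d))
          (extChartAt (𝓡 d) x) x v) : EuclideanSpace ℝ (Fin d)) = v := by
    have := mfderivWithin_extChartAt_symm_comp_mfderiv_extChartAt'
      (mem_extChartAt_source (I := 𝓡 d) x)
    rw [hr, mfderivWithin_univ] at this
    exact congrArg (fun f => f v) this
  have hbase := extChartAt_to_inv (I := 𝓡 d) x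
  have hform (v : TangentSpace (𝓡 d) x) :
      oneFormInChart η x (extChartAt (𝓡 d) x x) ![mfderiv (𝓡 d) 𝓘(ℝ, EuclideanSpace ℝ (Fin d))
          (extChartAt (𝓡 d) x) x v] = η x v := by
    refine (congrArg (η ((extChartAt (𝓡 d) x).symm (extChartAt (𝓡 d) x x))) (hsymm v)).trans ?_
    exact congrArg (fun z => (η z : EuclideanSpace ℝ (Fin d) →L[ℝ] ℝ) v) hbase
  have hval (V : ∀ x : M, TangentSpace (𝓡 d) x) :
      mpullback 𝓘(ℝ, EuclideanSpace ℝ (Fin d)) (𝓡 d) (extChartAt (𝓡 d) x).symm V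
        (extChartAt (𝓡 d) x x) = mfderiv (𝓡 d) 𝓘(ℝ, EuclideanSpace ℝ (Fin d))
          (extChartAt (𝓡 d) x) x (V x) := by
    refine (hinv _ (mem_extChartAt_target x)).inverse_apply_eq.2 ?_
    refine Eq.trans ?_ (hsymm (V x)).symm
    exact congrArg (fun z => (V z : EuclideanSpace ℝ (Fin d))) hbase
  have hbr : lieBracket ℝ (mpullback 𝓘(ℝ, EuclideanSpace ℝ (Fin d)) (𝓡 d)
        (extChartAt (𝓡 d) x).symm X) (mpullback 𝓘(ℝ, EuclideanSpace ℝ (Fin d)) (𝓡 d)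
        (extChartAt (𝓡 d) x).symm Y) (extChartAt (𝓡 d) x x) =
      mfderiv (𝓡 d) 𝓘(ℝ, EuclideanSpace ℝ (Fin d)) (extChartAt (𝓡 d) x) x
        (mlieBracket (𝓡 d) X Y x) := by
    -- The manifold bracket is by definition the chart bracket pulled back, so the chart's
    -- derivative undoes the pullback.
    rw [← mlieBracketWithin_univ, mlieBracketWithin_apply, hr, preimage_univ, univ_inter,
      mpullbackWithin_univ, mpullbackWithin_univ]
    refine Eq.trans ?_
      ((isInvertible_mfderiv_extChartAt (mem_extChartAt_source x)).self_apply_inverse _).symm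
    exact congrFun lieBracketWithin_univ.symm _
  rw [hval, hval, hbr, hform] at key
  exact key

theorem IsSmoothVectorField.endo {Φ : ∀ x : M, TangentSpace (𝓡 d) x →L[ℝ] TangentSpace (𝓡 d) x}
    (hΦ : IsSmoothEndo Φ) {X : ∀ x : M, TangentSpace (𝓡 d) x} (hX : IsSmoothVectorField X) :
    IsSmoothVectorField (fun x => Φ x (X x)) :=
  ContMDiff.clm_bundle_apply hΦ hX

theorem IsSmoothOneForm.contMDiff_apply {η : ∀ x : M, TangentSpace (𝓡 d) x →L[ℝ] ℝ}
    (hη : IsSmoothOneForm η) {X : ∀ x : M, TangentSpace (𝓡 d) x} (hX : IsSmoothVectorField X) :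
    ContMDiff (𝓡 d) 𝓘(ℝ, ℝ) ∞ (fun x => η x (X x)) := by
  have : ContMDiff (𝓡 d) ((𝓡 d).prod 𝓘(ℝ, ℝ)) ∞
      (fun x => Bundle.TotalSpace.mk' ℝ (E := Bundle.Trivial M ℝ) x (η x (X x))) :=
    ContMDiff.clm_bundle_apply (F₂ := ℝ) (E₂ := Bundle.Trivial M ℝ) hη hX
  exact fun x => ((Bundle.contMDiffAt_section x).1 (this x))

end

/-! ### Algebra of `dη` and `N_Φ` -/

section

variable {d : ℕ} {M : Type*} [TopologicalSpace M] [ChartedSpace (EuclideanSpace ℝ (Fin d)) M]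

theorem dOneForm_swap (η : ∀ x : M, TangentSpace (𝓡 d) x →L[ℝ] ℝ) (x : M)
    (v w : TangentSpace (𝓡 d) x) : dOneForm η x v w = -dOneForm η x w v := by
  have h (A : EuclideanSpace ℝ (Fin d) [⋀^Fin 2]→L[ℝ] ℝ) (u u' : EuclideanSpace ℝ (Fin d)) :
      A ![u, u'] = -A ![u', u] := by
    have := A.toAlternatingMap.map_swap ![u', u] (show (0 : Fin 2) ≠ 1 by decide)
    have e : ![u', u] ∘ Equiv.swap (0 : Fin 2) 1 = ![u, u'] := by
      funext i
      fin_cases i <;> rfl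
    rwa [e] at this
  exact h _ _ _

theorem dOneForm_add_left (η : ∀ x : M, TangentSpace (𝓡 d) x →L[ℝ] ℝ) (x : M)
    (v v' w : TangentSpace (𝓡 d) x) :
    dOneForm η x (v + v') w = dOneForm η x v w + dOneForm η x v' w := by
  unfold dOneForm
  rw [map_add]
  exact (extDeriv (oneFormInChart η x) (extChartAt (𝓡 d) x x)).map_vecCons_add _ _ _

theorem dOneForm_smul_left (η : ∀ x : M, TangentSpace (𝓡 d) x →L[ℝ] ℝ) (x : M)
    (c : ℝ) (v w : TangentSpace (𝓡 d) x) :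
    dOneForm η x (c • v) w = c * dOneForm η x v w := by
  unfold dOneForm
  rw [map_smul]
  exact (extDeriv (oneFormInChart η x) (extChartAt (𝓡 d) x x)).map_vecCons_smul _ _ _

theorem nijenhuis_swap (Φ : ∀ x : M, TangentSpace (𝓡 d) x →L[ℝ] TangentSpace (𝓡 d) x)
    (X Y : ∀ x : M, TangentSpace (𝓡 d) x) (x : M) :
    nijenhuis Φ X Y x = -nijenhuis Φ Y X x := by
  unfold nijenhuis
  rw [mlieBracket_swap_apply (V := fun y => Φ y (X y)) (W := fun y => Φ y (Y y)),
    mlieBracket_swap_apply (V := X) (W := Y),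
    mlieBracket_swap_apply (V := fun y => Φ y (X y)) (W := Y),
    mlieBracket_swap_apply (V := X) (W := fun y => Φ y (Y y))]
  simp only [map_neg]
  abel

variable [IsManifold (𝓡 d) ∞ M]

theorem IsSmoothVectorField.mdifferentiableAt {X : ∀ x : M, TangentSpace (𝓡 d) x}
    (hX : IsSmoothVectorField X) (x : M) :
    MDifferentiableAt (𝓡 d) ((𝓡 d).prod 𝓘(ℝ, EuclideanSpace ℝ (Fin d)))
      (fun y => (X y : TangentBundle (𝓡 d) M)) x :=
  (hX x).mdifferentiableAt (by simp)

theorem nijenhuis_add_left {Φ : ∀ x : M, TangentSpace (𝓡 d) x →L[ℝ] TangentSpace (𝓡 d) x}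
    (hΦ : IsSmoothEndo Φ) {X X' : ∀ x : M, TangentSpace (𝓡 d) x} (hX : IsSmoothVectorField X)
    (hX' : IsSmoothVectorField X') (Y : ∀ x : M, TangentSpace (𝓡 d) x) (x : M) :
    nijenhuis Φ (X + X') Y x = nijenhuis Φ X Y x + nijenhuis Φ X' Y x := by
  have h : (fun y => Φ y ((X + X') y)) = (fun y => Φ y (X y)) + fun y => Φ y (X' y) :=
    funext fun y => map_add (Φ y) _ _
  unfold nijenhuis
  rw [h, mlieBracket_add_left ((hX.endo hΦ).mdifferentiableAt x)
      ((hX'.endo hΦ).mdifferentiableAt x),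
    mlieBracket_add_left ((hX.endo hΦ).mdifferentiableAt x) ((hX'.endo hΦ).mdifferentiableAt x),
    mlieBracket_add_left (hX.mdifferentiableAt x) (hX'.mdifferentiableAt x),
    mlieBracket_add_left (hX.mdifferentiableAt x) (hX'.mdifferentiableAt x)]
  simp only [map_add]
  abel

omit [IsManifold (𝓡 d) ∞ M] in
theorem nijenhuis_left_of_apply_eq_zero
    {Φ : ∀ x : M, TangentSpace (𝓡 d) x →L[ℝ] TangentSpace (𝓡 d) x}
    {Z : ∀ x : M, TangentSpace (𝓡 d) x} (hZ : ∀ x, Φ x (Z x) = 0)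
    (Y : ∀ x : M, TangentSpace (𝓡 d) x) (x : M) :
    nijenhuis Φ Z Y x = -Φ x (lieDerivEndo Z Φ Y x) := by
  have h : (fun y => Φ y (Z y)) = 0 := funext hZ
  unfold nijenhuis lieDerivEndo
  rw [h, mlieBracket_zero_left, mlieBracket_zero_left, map_sub]
  simp only [Pi.zero_apply, map_zero]
  abel

/-- The terms that differentiate `f` are multiples of `Z`, hence killed by the outer `Φ`. -/
theorem apply_lieDerivEndo_smul {Φ : ∀ x : M, TangentSpace (𝓡 d) x →L[ℝ] TangentSpace (𝓡 d) x}
    {Z : ∀ x : M, TangentSpace (𝓡 d) x} (hZ : IsSmoothVectorField Z) (hΦZ : ∀ x, Φ x (Z x) = 0)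
    {f : M → ℝ} (hf : ContMDiff (𝓡 d) 𝓘(ℝ, ℝ) ∞ f) (Y : ∀ x : M, TangentSpace (𝓡 d) x) (x : M) :
    Φ x (lieDerivEndo (f • Z) Φ Y x) = f x • Φ x (lieDerivEndo Z Φ Y x) := by
  have hf' : MDifferentiableAt (𝓡 d) 𝓘(ℝ, ℝ) f x := (hf x).mdifferentiableAt (by simp)
  unfold lieDerivEndo
  rw [mlieBracket_smul_left hf' (hZ.mdifferentiableAt x),
    mlieBracket_smul_left hf' (hZ.mdifferentiableAt x)]
  simp only [map_sub, map_add, map_smul, hΦZ, smul_zero, zero_add, smul_sub]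

/-! ### The two implications -/

namespace ContactMetricStructure

variable (S : ContactMetricStructure d M)

theorem η_Φ (x : M) (v : TangentSpace (𝓡 d) x) : S.η x (S.Φ x v) = 0 := S.Φ_mem_D x v

theorem dη_Φ_right_symm (x : M) (v w : TangentSpace (𝓡 d) x) :
    dOneForm S.η x v (S.Φ x w) = dOneForm S.η x w (S.Φ x v) := by
  have h := S.g_eq x v w
  rw [S.g.symm, S.g_eq x w v] at h
  linarith [mul_comm (S.η x v) (S.η x w)]

/-- Symmetry of `g` makes `dη(·, Φ·)` symmetric, while `dη` is alternating. This puts `[X, JY] +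
[JX, Y]` in `D`. -/
theorem dη_Φ_add (x : M) (v w : TangentSpace (𝓡 d) x) :
    dOneForm S.η x v (S.Φ x w) + dOneForm S.η x (S.Φ x v) w = 0 := by
  rw [dη_Φ_right_symm, dOneForm_swap S.η x (S.Φ x v)]
  ring

/-- `-Φ²` is the projection onto `D` along `ξ`, and `ξ` lies in the kernel of `dη`. -/
theorem dη_neg_Φ_sq (x : M) (v w : TangentSpace (𝓡 d) x) :
    dOneForm S.η x (-S.Φ x (S.Φ x v)) (-S.Φ x (S.Φ x w)) = dOneForm S.η x v w := by
  have h (v w : TangentSpace (𝓡 d) x) :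
      dOneForm S.η x (-S.Φ x (S.Φ x v)) w = dOneForm S.η x v w := by
    have : -S.Φ x (S.Φ x v) = v + (-S.η x v) • S.ξ x := by
      rw [S.Φ_sq, neg_smul]; abel
    rw [this, dOneForm_add_left, dOneForm_smul_left, S.dη_ξ, mul_zero, add_zero]
  rw [h, dOneForm_swap, h, ← dOneForm_swap]

theorem smooth_neg_Φ_sq {X : ∀ x : M, TangentSpace (𝓡 d) x} (hX : IsSmoothVectorField X) :
    IsSmoothVectorField fun x => -S.Φ x (S.Φ x (X x)) :=
  ContMDiff.neg_section ((hX.endo S.smooth_Φ).endo S.smooth_Φ)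

theorem smooth_η_smul_ξ {X : ∀ x : M, TangentSpace (𝓡 d) x} (hX : IsSmoothVectorField X) :
    IsSmoothVectorField ((fun x => S.η x (X x)) • S.ξ) :=
  ContMDiff.smul_section (S.contact.smooth.contMDiff_apply hX) S.smooth_ξ

theorem lieDerivVanishes_of_isNormal (h : S.IsNormal) : S.LieDerivVanishes := by
  intro Y hY x
  have h1 := h S.ξ Y S.smooth_ξ hY x
  rw [nijenhuis_left_of_apply_eq_zero S.Φ_ξ, S.dη_ξ, zero_smul, neg_inj] at h1
  have h2 : S.η x (lieDerivEndo S.ξ S.Φ Y x) = 0 := by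
    have := dOneForm_eq_neg_apply_mlieBracket S.contact.smooth S.smooth_ξ (hY.endo S.smooth_Φ)
      S.η_ξ (fun y => S.η_Φ y (Y y)) x
    rw [S.dη_ξ] at this
    unfold lieDerivEndo
    rw [map_sub, S.η_Φ]
    linarith
  -- A vector annihilated by both `Φ` and `η` is zero, by the formula for `Φ²`.
  have h3 := S.Φ_sq x (lieDerivEndo S.ξ S.Φ Y x)
  rw [h1, h2, map_zero, zero_smul, add_zero] at h3
  exact neg_eq_zero.1 h3.symm

theorem isIntegrableCR_of_isNormal (h : S.IsNormal) : IsIntegrableCR S.D S.J := by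
  intro X Y hX hY x
  have hJX := hX.endo S.smooth_Φ
  have hJY := hY.endo S.smooth_Φ
  have b1 := dOneForm_eq_neg_apply_mlieBracket S.contact.smooth hX hJY
    (fun y => (X y).2) (fun y => S.η_Φ y (Y y)) x
  have b2 := dOneForm_eq_neg_apply_mlieBracket S.contact.smooth hJX hY
    (fun y => S.η_Φ y (X y)) (fun y => (Y y).2) x
  have b3 := dOneForm_eq_neg_apply_mlieBracket S.contact.smooth hX hY
    (fun y => (X y).2) (fun y => (Y y).2) x
  refine ⟨?_, ?_⟩
  · change S.η x _ = 0
    refine (map_add (S.η x) _ _).trans ?_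
    have := S.dη_Φ_add x (X x) (Y x)
    rw [b1, b2] at this
    have h' := neg_eq_zero.1 ((neg_add _ _).trans this)
    exact h'
  · have h1 := h _ _ hX hY x
    rw [b3] at h1
    unfold nijenhuis at h1
    rw [S.Φ_sq] at h1
    change S.Φ x (_ + _) = _
    rw [map_add]
    exact add_sub_sub_eq_neg_neg_smul_iff.1 h1

theorem isNormal_of_isIntegrableCR (h : IsIntegrableCR S.D S.J) (h' : S.LieDerivVanishes) :
    S.IsNormal := by
  have red (X Y : ∀ x : M, TangentSpace (𝓡 d) x) (hX : IsSmoothVectorField X)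
      (hY : IsSmoothVectorField Y) (x : M) :
      nijenhuis S.Φ X Y x = nijenhuis S.Φ (fun y => -S.Φ y (S.Φ y (X y))) Y x := by
    have hd : X = (fun y => -S.Φ y (S.Φ y (X y))) + (fun y => S.η y (X y)) • S.ξ := by
      funext y
      change X y = -S.Φ y (S.Φ y (X y)) + S.η y (X y) • S.ξ y
      rw [S.Φ_sq]; abel
    have hz : ∀ y, S.Φ y (((fun y => S.η y (X y)) • S.ξ) y) = 0 := fun y =>
      (map_smul (S.Φ y) (S.η y (X y)) (S.ξ y)).trans (by rw [S.Φ_ξ, smul_zero])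
    conv_lhs => rw [hd]
    rw [nijenhuis_add_left S.smooth_Φ (S.smooth_neg_Φ_sq hX) (S.smooth_η_smul_ξ hX),
      nijenhuis_left_of_apply_eq_zero hz,
      apply_lieDerivEndo_smul S.smooth_ξ S.Φ_ξ (S.contact.smooth.contMDiff_apply hX),
      h' Y hY x, map_zero, smul_zero, neg_zero, add_zero]
  intro X Y hX hY x
  have hX' := S.smooth_neg_Φ_sq hX
  have hY' := S.smooth_neg_Φ_sq hY
  -- `red` projects only the first argument; antisymmetry of `N_Φ` handles the second.
  rw [red X Y hX hY, nijenhuis_swap, red Y _ hY hX', ← nijenhuis_swap]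
  have mem (V : ∀ x : M, TangentSpace (𝓡 d) x) (y : M) : -S.Φ y (S.Φ y (V y)) ∈ S.D y :=
    (S.D y).neg_mem (S.Φ_mem_D y _)
  have b := dOneForm_eq_neg_apply_mlieBracket S.contact.smooth hX' hY'
    (fun y => mem X y) (fun y => mem Y y) x
  obtain ⟨_, e⟩ := h (fun y => ⟨_, mem X y⟩) (fun y => ⟨_, mem Y y⟩) hX' hY' x
  rw [S.dη_neg_Φ_sq] at b
  rw [b]
  have e' := (map_add (S.Φ x) _ _).symm.trans e
  unfold nijenhuis
  rw [S.Φ_sq]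
  exact add_sub_sub_eq_neg_neg_smul_iff.2 e'

end ContactMetricStructure

end

end ContactGeometry

theorem proposition3p5 (n : ℕ) {M : Type*} [TopologicalSpace M] [T2Space M]
    [ChartedSpace (EuclideanSpace ℝ (Fin (2 * n + 1))) M]
    [IsManifold (𝓡 (2 * n + 1)) ∞ M]
    (S : ContactGeometry.ContactMetricStructure (2 * n + 1) M) :
    S.IsNormal ↔ ContactGeometry.IsIntegrableCR S.D S.J ∧ S.LieDerivVanishes :=
  ⟨fun h => ⟨S.isIntegrableCR_of_isNormal h, S.lieDerivVanishes_of_isNormal h⟩,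
    fun h => S.isNormal_of_isIntegrableCR h.1 h.2⟩
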